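/- For each sample size $n$, let $\mathscr D_n=\{(x_i,y_i)\}_{i=1}^n$ be a random dataset (all objects may depend on $n$) with $x_i\in\mathbb R^{p}$, $y_i\in\mathbb R$ and $$y_i=x_i'\theta_0+\varepsilon_i,$$ where $\theta_0\in\mathbb R^p$ is a nonrandom parameter, the $\varepsilon_i$ are random disturbances, and the covariates are normalized so that $\mathbb E_n[x_{ij}]=0$ and $\mathbb E_n[x_{ij}^2]=1$ for every $j$. Here $\mathbb E_n[\cdot]=\frac1n\sum_{i=1}^n(\cdot)$. Let $s_0$ be the number of nonzero components of $\theta_0$ and let $t\ge 0$ be a nonrandom threshold. Write $\ell(\theta)=\mathbb E_n[(y_i-x_i'\theta)^2]$ and, for $S\subseteq\{1,\dots,p\}$, $\ell(S)=\min_{\mathrm{supp}(\theta)\subseteq S}\ell(\theta)$ and $\Delta_j\ell(S)=\ell(S\cup\{j\})-\ell(S)$. Forward regression with threshold $t$ starts with $\hat S=\emptyset$; as long as $-\Delta_j\ell(\hat S)>t$ for some $j\notin\hat S$, it adds to $\hat S$ an index $j\notin\hat S$ that maximizes $-\Delta_j\ell(\hat S)$ (ties are broken arbitrarily); otherwise it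 stops. Let $\hat S$ be the final set, $\hat s=|\hat S|$, and let $\hat\theta$ be any minimizer of $\ell(\theta)$ over $\mathrm{supp}(\theta)\subseteq\hat S$. Let $G_x=\mathbb E_n[x_ix_i']$ and, for an integer $s\ge1$, let $\varphi_{\min}(s)(G_x)=\min_{\emptyset\ne S\subseteq\{1,\dots,p\},\,|S|\le s}\lambda_{\min}([G_x]_{S,S})$ be the minimal $s$-sparse eigenvalue. Assume: 1. $s_0=o(n)$. 2. There is a nonrandom sequence of integers $K_n\ge1$ with $s_0=o(K_n)$ and a constant $C_0$, not depending on $n$, such that with probability $1-o(1)$ one has $\varphi_{\min}(K_n)(G_x)>0$ and $\varphi_{\min}(K_n)(G_x)^{-1}\le C_0$. 3. $t=O(\log p/n)$, and with probability $1-o(1)$, $t^{1/2}\ge 2\,\varphi_{\min}(K_n)(G_x)^{-1}\,\|\mathbb E_n[x_i\varepsilon_i]\|_\infty$. Then there is a constant $C$, not depending on $n$, such that with probability $1-o(1)$ both bounds $$\mathbb E_n[(x_i'\theta_0-x_i'\hat\theta)^2]^{1/2}\le C\sqrt{\frac{s_0\log p}{n}},\qquad \hat s\le C\,s_0$$ hold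 simultaneously. -/

import Mathlib

open Filter Topology MeasureTheory Asymptotics
open scoped Matrix

noncomputable section

namespace ForwardRegression

/-- Empirical expectation: the average of `f i` over the `n` observations. -/
def En {n : ℕ} (f : Fin n → ℝ) : ℝ := (1 / (n : ℝ)) * ∑ i, f i

/-- Row `i` of `x` is the covariate vector of observation `i`. Every covariate has empirical
mean zero and empirical second moment one. -/
def Normalized {n p : ℕ} (x : Matrix (Fin n) (Fin p) ℝ) : Prop :=
  ∀ j, En (fun i => x i j) = 0 ∧ En (fun i => x i j ^ 2) = 1

/-- The number of nonzero components of `θ`. -/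
def sparsity {p : ℕ} (θ : Fin p → ℝ) : ℕ := (Function.support θ).ncard

/-- `θ` vanishes outside `S`. -/
def SupportedOn {p : ℕ} (S : Finset (Fin p)) (θ : Fin p → ℝ) : Prop := ∀ j, j ∉ S → θ j = 0

/-- The least squares loss of a parameter. -/
def loss {n p : ℕ} (x : Matrix (Fin n) (Fin p) ℝ) (y : Fin n → ℝ) (θ : Fin p → ℝ) : ℝ :=
  En (fun i => (y i - (x *ᵥ θ) i) ^ 2)

/-- The loss of a set of covariates: the minimal loss over parameters supported on it
(the minimum is attained, so it is the infimum). -/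
def setLoss {n p : ℕ} (x : Matrix (Fin n) (Fin p) ℝ) (y : Fin n → ℝ) (S : Finset (Fin p)) : ℝ :=
  sInf (loss x y '' {θ | SupportedOn S θ})

/-- The incremental loss from covariate `j`. -/
def incLoss {n p : ℕ} (x : Matrix (Fin n) (Fin p) ℝ) (y : Fin n → ℝ) (j : Fin p)
    (S : Finset (Fin p)) : ℝ :=
  setLoss x y (insert j S) - setLoss x y S

/-- The working models that forward regression with threshold `t` can pass through: start with the
empty set; at each step add an unselected covariate whose decrease of the loss exceeds `t` and is
largest among all unselected covariates (ties may be broken arbitrarily). -/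
inductive Reachable {n p : ℕ} (x : Matrix (Fin n) (Fin p) ℝ) (y : Fin n → ℝ) (t : ℝ) :
    Finset (Fin p) → Prop
  | init : Reachable x y t ∅
  | update (S : Finset (Fin p)) (j : Fin p) (hS : Reachable x y t S) (hj : j ∉ S)
      (ht : t < -incLoss x y j S) (hmax : ∀ k, k ∉ S → -incLoss x y k S ≤ -incLoss x y j S) :
      Reachable x y t (insert j S)

/-- `(S, θ)` is an output of forward regression with threshold `t`: `S` is a working model at which
the algorithm stops, and `θ` is a least squares estimator supported on `S`. -/
structure IsOutput {n p : ℕ} (x : Matrix (Fin n) (Fin p) ℝ) (y : Fin n → ℝ) (t : ℝ)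
    (S : Finset (Fin p)) (θ : Fin p → ℝ) : Prop where
  reachable : Reachable x y t S
  terminal : ∀ j, j ∉ S → ¬ t < -incLoss x y j S
  supported : SupportedOn S θ
  least : ∀ θ', SupportedOn S θ' → loss x y θ ≤ loss x y θ'

/-- The prediction error norm between two parameters. -/
def predErr {n p : ℕ} (x : Matrix (Fin n) (Fin p) ℝ) (θ₀ θ : Fin p → ℝ) : ℝ :=
  Real.sqrt (En (fun i => ((x *ᵥ θ₀) i - (x *ᵥ θ) i) ^ 2))

/-- The empirical Gram matrix. -/
def gram {n p : ℕ} (x : Matrix (Fin n) (Fin p) ℝ) : Matrix (Fin p) (Fin p) ℝ :=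
  Matrix.of fun j k => En (fun i => x i j * x i k)

/-- The smallest eigenvalue of a (symmetric) real matrix. -/
def lambdaMin {ι : Type*} [Fintype ι] [DecidableEq ι] (A : Matrix ι ι ℝ) : ℝ :=
  sInf (spectrum ℝ A)

/-- The minimal `s`-sparse eigenvalue: the minimum of the smallest eigenvalues of the principal
submatrices on nonempty index sets with at most `s` elements (a minimum over finitely many
sets). -/
def sparseMinEig {p : ℕ} (s : ℕ) (G : Matrix (Fin p) (Fin p) ℝ) : ℝ :=
  sInf {l | ∃ S : Finset (Fin p), S.Nonempty ∧ S.card ≤ s ∧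
    l = lambdaMin (G.submatrix (fun j : S => (j : Fin p)) (fun j : S => (j : Fin p)))}

/-- The maximum over the covariates of the absolute empirical covariance with the disturbance
(the norm on `Fin p → ℝ` is the maximum norm). -/
def noiseSup {n p : ℕ} (x : Matrix (Fin n) (Fin p) ℝ) (ε : Fin n → ℝ) : ℝ :=
  ‖(fun j => En (fun i => x i j * ε i) : Fin p → ℝ)‖

/-- The property `P n` holds with probability `1 - o(1)`. (On an event that is not measurable, `μ n`
is the outer measure, so the exceptional set lies in a measurable set of vanishing probability.) -/
def WithProbTendingToOne {Ω : ℕ → Type*} [∀ n, MeasurableSpace (Ω n)]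
    (μ : ∀ n, Measure (Ω n)) (P : ∀ n, Ω n → Prop) : Prop :=
  Tendsto (fun n => μ n {ω | ¬ P n ω}) atTop (𝓝 0)

end ForwardRegression

end

/-!
The proof is deterministic: on the event where the sparse eigenvalue `φ` is bounded below and the
noise is small, every path of forward regression obeys the bounds. Covariates, signal and noise
become vectors of a Hilbert space, the loss of a model `S` is the squared distance to the span of its
covariates, and the decrease of the loss at a step is the squared length of the change of the
projection (`gain`).

Let `S₀` be the support of `θ₀`, let `b(S)` be the squared length of the part of the signal that `S`
does not explain (`bias`), and let `L(S)` and `Q(S)` be the `ℓ¹` norm and the squared `ℓ²` norm of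
`θ₀` on `S₀ \ S`. By Hölder's inequality some remaining index of `S₀` has covariance at least
`b / L` with the unexplained signal, so every step, whichever index it selects, lowers `b` by a
multiple of `b² / L²`. Equivalently, `L² / b` grows by a constant while `L` does not change. Selecting
an index of `S₀` shrinks `L`, which may cost `L² / b` much more than a constant. However,
`b ≥ φ Q`, and the potential `φ L² / b + L² / Q` loses at most four at such a step
(`potential_remove`), because the second term grows when the first one drops a lot. As the potential
lies between `0` and `2 |S₀|`, the number of steps is `O(|S₀| / φ)`, whatever the scales of the
coefficients, and no upper sparse eigenvalue is needed.

The noise is not small in each direction, but its projection on the span of `S` has squared length at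
most `φ t |S| / 4`. Since each step gains more than `t`, only a fraction of the steps can be dominated
by noise, and these are charged to the length of the projected noise
(`SparseRegression.le_potential`). This works as long as `b` exceeds the noise level
`φ t (|S| + |S₀|)`. Once it does not, the remaining steps are counted through the total loss that is
left to gain (`SparseRegression.card_le_of_pos`). The eigenvalue bound is only available for models
of size at most `K`, so the count is applied to prefixes of the path. The error bound follows from the
stopping rule by the same use of Hölder's inequality (`SparseRegression.norm_sub_proj_le`).
-/

open scoped RealInnerProductSpace

namespace ForwardRegression

/-! ### Projections onto spans of covariates -/

section Span

variable {ι E : Type*} [NormedAddCommGroup E] [InnerProductSpace ℝ E]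

/-- The linear combination of the vectors `X i` with coefficients `c i`. -/
def comb [Fintype ι] (X : ι → E) (c : ι → ℝ) : E := ∑ i, c i • X i

/-- The span of the covariates with index in `S`. -/
def covSpan (X : ι → E) (S : Finset ι) : Submodule ℝ E := Submodule.span ℝ (X '' S)

lemma mem_covSpan (X : ι → E) {S : Finset ι} {j : ι} (hj : j ∈ S) : X j ∈ covSpan X S :=
  Submodule.subset_span ⟨j, hj, rfl⟩

lemma covSpan_mono (X : ι → E) {S T : Finset ι} (h : S ⊆ T) : covSpan X S ≤ covSpan X T :=
  Submodule.span_mono (Set.image_mono (by exact_mod_cast h))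

lemma comb_eq_sum [Fintype ι] (X : ι → E) {S : Finset ι} {c : ι → ℝ} (hc : ∀ i ∉ S, c i = 0) :
    comb X c = ∑ i ∈ S, c i • X i := by
  unfold comb
  symm
  apply Finset.sum_subset (Finset.subset_univ S)
  intro i _ hi
  simp [hc i hi]

lemma comb_mem_covSpan [Fintype ι] (X : ι → E) {S : Finset ι} {c : ι → ℝ}
    (hc : ∀ i ∉ S, c i = 0) : comb X c ∈ covSpan X S := by
  rw [comb_eq_sum X hc]
  exact Submodule.sum_mem _ fun i hi => Submodule.smul_mem _ _ (mem_covSpan X hi)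

lemma exists_comb_eq [Fintype ι] (X : ι → E) {S : Finset ι} {u : E} (hu : u ∈ covSpan X S) :
    ∃ c : ι → ℝ, (∀ i ∉ S, c i = 0) ∧ comb X c = u := by
  classical
  obtain ⟨c, hc⟩ := (Submodule.mem_span_image_finset_iff_exists_fun' (R := ℝ)).1 hu
  refine ⟨fun i => if i ∈ S then c i else 0, fun i hi => by simp [hi], ?_⟩
  rw [comb_eq_sum X (S := S) (fun i hi => by simp [hi]), ← hc]
  exact Finset.sum_congr rfl fun i hi => by simp [hi]

end Span

section Projection

variable {ι E : Type*} [NormedAddCommGroup E] [InnerProductSpace ℝ E] [FiniteDimensional ℝ E]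

/-- The orthogonal projection onto the span of the covariates with index in `S`, as a map from `E`
to itself. -/
noncomputable def proj (X : ι → E) (S : Finset ι) : E →L[ℝ] E := (covSpan X S).starProjection

variable (X : ι → E)

lemma proj_mem (S : Finset ι) (v : E) : proj X S v ∈ covSpan X S :=
  Submodule.starProjection_apply_mem _ _

lemma proj_eq_self {S : Finset ι} {v : E} (hv : v ∈ covSpan X S) : proj X S v = v :=
  Submodule.starProjection_eq_self_iff.2 hv

lemma inner_proj (S : Finset ι) (u v : E) : ⟪proj X S u, v⟫ = ⟪u, proj X S v⟫ :=
  Submodule.inner_starProjection_left_eq_right _ _ _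

lemma proj_proj_of_subset {S T : Finset ι} (h : S ⊆ T) (v : E) :
    proj X S (proj X T v) = proj X S v :=
  DFunLike.congr_fun (Submodule.starProjection_comp_starProjection_of_le (covSpan_mono X h)) v

lemma inner_proj_self (S : Finset ι) (v : E) : ⟪proj X S v, v⟫ = ‖proj X S v‖ ^ 2 := by
  rw [← proj_eq_self X (proj_mem X S v), inner_proj, proj_eq_self X (proj_mem X S v),
    real_inner_self_eq_norm_sq]

lemma norm_proj_sub_proj_sq {S T : Finset ι} (h : S ⊆ T) (v : E) :
    ‖proj X T v - proj X S v‖ ^ 2 = ‖proj X T v‖ ^ 2 - ‖proj X S v‖ ^ 2 := by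
  have : ⟪proj X T v, proj X S v⟫ = ‖proj X S v‖ ^ 2 := by
    rw [← inner_proj, proj_proj_of_subset X h, inner_proj_self]
  rw [norm_sub_sq_real, this]
  ring

lemma norm_sub_proj_sq (S : Finset ι) (v : E) :
    ‖v - proj X S v‖ ^ 2 = ‖v‖ ^ 2 - ‖proj X S v‖ ^ 2 := by
  rw [norm_sub_sq_real, real_inner_comm, inner_proj_self]
  ring

lemma norm_proj_mono {S T : Finset ι} (h : S ⊆ T) (v : E) : ‖proj X S v‖ ^ 2 ≤ ‖proj X T v‖ ^ 2 := by
  have := norm_proj_sub_proj_sq X h v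
  nlinarith [sq_nonneg ‖proj X T v - proj X S v‖]

lemma norm_sub_sq_of_mem {S : Finset ι} {u : E} (hu : u ∈ covSpan X S) (v : E) :
    ‖v - u‖ ^ 2 = ‖v - proj X S v‖ ^ 2 + ‖proj X S v - u‖ ^ 2 := by
  have h1 : ⟪v - proj X S v, proj X S v - u⟫ = 0 :=
    Submodule.starProjection_inner_eq_zero _ _ (Submodule.sub_mem _ (proj_mem X S v) hu)
  have h2 : v - u = (v - proj X S v) + (proj X S v - u) := by abel
  rw [h2, norm_add_sq_real, h1]
  ring

end Projection

/-! ### Gains of forward regression -/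

section Gain

variable {ι E : Type*} [DecidableEq ι] [NormedAddCommGroup E] [InnerProductSpace ℝ E]
  [FiniteDimensional ℝ E]

/-- The decrease of the squared distance of `y` to the span when `j` joins the working model
`S`. -/
noncomputable def gain (X : ι → E) (y : E) (S : Finset ι) (j : ι) : ℝ :=
  ‖proj X (insert j S) y‖ ^ 2 - ‖proj X S y‖ ^ 2

lemma gain_eq (X : ι → E) (y : E) (S : Finset ι) (j : ι) :
    gain X y S j = ‖proj X (insert j S) y - proj X S y‖ ^ 2 :=
  (norm_proj_sub_proj_sq X (Finset.subset_insert j S) y).symm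

/-- The gain from a covariate of norm at most one dominates the squared covariance of its
residual with `y`. -/
lemma inner_residual_sq_le_gain (X : ι → E) (y : E) (S : Finset ι) {j : ι} (hX : ‖X j‖ ≤ 1) :
    ⟪X j - proj X S (X j), y⟫ ^ 2 ≤ gain X y S j := by
  have h : ⟪X j - proj X S (X j), y⟫ = ⟪X j, proj X (insert j S) y - proj X S y⟫ := by
    rw [inner_sub_left, inner_sub_right, inner_proj, ← inner_proj X (insert j S),
      proj_eq_self X (mem_covSpan X (Finset.mem_insert_self j S))]
  rw [h, gain_eq, ← sq_abs]
  gcongr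
  calc |⟪X j, proj X (insert j S) y - proj X S y⟫|
      ≤ ‖X j‖ * ‖proj X (insert j S) y - proj X S y‖ := abs_real_inner_le_norm _ _
    _ ≤ 1 * ‖proj X (insert j S) y - proj X S y‖ := by gcongr
    _ = _ := one_mul _

/-- The working models of forward regression on vectors `X` with response `y`: each step gains
more than `t` and gains the most among all unselected covariates. -/
inductive Greedy (X : ι → E) (y : E) (t : ℝ) : Finset ι → Prop
  | init : Greedy X y t ∅
  | update (S : Finset ι) (j : ι) (hS : Greedy X y t S) (hj : j ∉ S) (ht : t < gain X y S j)
      (hmax : ∀ k, k ∉ S → gain X y S k ≤ gain X y S j) : Greedy X y t (insert j S)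

lemma Greedy.anti {X : ι → E} {y : E} {t t' : ℝ} (h : t ≤ t') {S : Finset ι}
    (hS : Greedy X y t' S) : Greedy X y t S := by
  induction hS with
  | init => exact .init
  | update S j _ hj ht hmax ih => exact .update S j ih hj (h.trans_lt ht) hmax

/-- A path of forward regression has finitely many steps, so its threshold can be raised a
little. This makes the threshold positive. -/
lemma Greedy.exists_lt {X : ι → E} {y : E} {t : ℝ} {S : Finset ι} (hS : Greedy X y t S) :
    ∃ t' > t, Greedy X y t' S := by
  induction hS with
  | init => exact ⟨t + 1, by linarith, .init⟩
  | update S j _ hj ht hmax ih =>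
    obtain ⟨t₁, h₁, hS₁⟩ := ih
    obtain ⟨t₂, h₂, h₃⟩ := exists_between ht
    exact ⟨min t₁ t₂, lt_min h₁ h₂,
      .update S j (hS₁.anti (min_le_left _ _)) hj ((min_le_right _ _).trans_lt h₃) hmax⟩

/-- A path of forward regression passes through models of every smaller size. -/
lemma Greedy.exists_card_eq {X : ι → E} {y : E} {t : ℝ} {S : Finset ι} (hS : Greedy X y t S)
    {m : ℕ} (hm : m ≤ S.card) : ∃ T, Greedy X y t T ∧ T.card = m := by
  induction hS with
  | init => exact ⟨∅, .init, (Nat.le_zero.1 hm).symm⟩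
  | update S j hS hj ht hmax ih =>
    rcases hm.lt_or_eq with h | h
    · rw [Finset.card_insert_of_notMem hj] at h
      exact ih (Nat.lt_succ_iff.1 h)
    · exact ⟨_, .update S j hS hj ht hmax, h.symm⟩

end Gain

/-! ### Sparse regression with small noise -/

/-- The deterministic content of the assumptions, in a Hilbert space: the covariates `X j` have norm
at most one, combinations of at most `K` of them have sparse eigenvalues at least `φ`, the signal
is `comb X θ` with `θ` supported on `S₀`, and the noise `ε` is nearly uncorrelated with each
covariate, relative to the threshold `t`. -/
structure SparseRegression {ι E : Type*} [Fintype ι] [NormedAddCommGroup E]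
    [InnerProductSpace ℝ E] (X : ι → E) (θ : ι → ℝ) (ε : E) (S₀ : Finset ι) (φ t : ℝ) (K : ℕ) :
    Prop where
  norm_le : ∀ j, ‖X j‖ ≤ 1
  eig_pos : 0 < φ
  eig_le_one : φ ≤ 1
  eig_le : ∀ (T : Finset ι) (c : ι → ℝ), T.card ≤ K → (∀ i ∉ T, c i = 0) →
    φ * ∑ i ∈ T, c i ^ 2 ≤ ‖comb X c‖ ^ 2
  supp : ∀ i ∉ S₀, θ i = 0
  noise : ∀ j, 2 * |⟪X j, ε⟫| ≤ φ * √t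

/-- The `ℓ¹` norm of the part of `θ` on indices of `S₀` outside `S`. -/
def restL1 {ι : Type*} [DecidableEq ι] (θ : ι → ℝ) (S₀ S : Finset ι) : ℝ := ∑ k ∈ S₀ \ S, |θ k|

/-- The squared `ℓ²` norm of the part of `θ` on indices of `S₀` outside `S`. -/
def restL2 {ι : Type*} [DecidableEq ι] (θ : ι → ℝ) (S₀ S : Finset ι) : ℝ := ∑ k ∈ S₀ \ S, θ k ^ 2

/-- The squared norm of the part of the signal that the working model `S` does not explain. -/
noncomputable def bias {ι E : Type*} [Fintype ι] [NormedAddCommGroup E] [InnerProductSpace ℝ E]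
    [FiniteDimensional ℝ E] (X : ι → E) (θ : ι → ℝ) (S : Finset ι) : ℝ :=
  ‖comb X θ - proj X S (comb X θ)‖ ^ 2

section Rest

variable {ι : Type*} [DecidableEq ι] (θ : ι → ℝ) (S₀ : Finset ι)

lemma restL1_nonneg (S : Finset ι) : 0 ≤ restL1 θ S₀ S := Finset.sum_nonneg fun _ _ => abs_nonneg _

lemma restL2_nonneg (S : Finset ι) : 0 ≤ restL2 θ S₀ S := Finset.sum_nonneg fun _ _ => sq_nonneg _

lemma restL1_sq_le (S : Finset ι) : restL1 θ S₀ S ^ 2 ≤ S₀.card * restL2 θ S₀ S := by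
  have h := sq_sum_le_card_mul_sum_sq (s := S₀ \ S) (f := fun k => |θ k|)
  simp only [sq_abs] at h
  refine h.trans (mul_le_mul_of_nonneg_right ?_ (restL2_nonneg θ S₀ S))
  exact_mod_cast Finset.card_le_card Finset.sdiff_subset

lemma sdiff_insert_of_notMem {S : Finset ι} {j : ι} (hj : j ∉ S₀) :
    S₀ \ insert j S = S₀ \ S := by
  ext k
  simp only [Finset.mem_sdiff, Finset.mem_insert]
  grind

lemma sum_sdiff_insert (f : ι → ℝ) {S : Finset ι} {j : ι} (hj : j ∈ S₀) (hjS : j ∉ S) :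
    ∑ k ∈ S₀ \ S, f k = ∑ k ∈ S₀ \ insert j S, f k + f j := by
  have h : S₀ \ S = insert j (S₀ \ insert j S) := by
    ext k
    simp only [Finset.mem_sdiff, Finset.mem_insert]
    grind
  rw [h, Finset.sum_insert (by simp), add_comm]

end Rest

section Bounds

variable {ι E : Type*} [Fintype ι] [NormedAddCommGroup E] [InnerProductSpace ℝ E]
  {X : ι → E} {θ : ι → ℝ} {ε : E} {S₀ : Finset ι} {φ t : ℝ} {K : ℕ}

/-- The noise is nearly orthogonal to every sparse combination of covariates. -/
lemma SparseRegression.inner_noise_sq_le (h : SparseRegression X θ ε S₀ φ t K) (ht : 0 ≤ t)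
    {T : Finset ι} (hK : T.card ≤ K) {u : E} (hu : u ∈ covSpan X T) :
    ⟪u, ε⟫ ^ 2 ≤ φ * t * T.card / 4 * ‖u‖ ^ 2 := by
  obtain ⟨c, hc, rfl⟩ := exists_comb_eq X hu
  have h1 : ⟪comb X c, ε⟫ = ∑ i ∈ T, c i * ⟪X i, ε⟫ := by
    rw [comb_eq_sum X hc, sum_inner]
    simp [real_inner_smul_left]
  have h2 : ∑ i ∈ T, ⟪X i, ε⟫ ^ 2 ≤ T.card * (φ ^ 2 * t / 4) := by
    rw [← nsmul_eq_mul]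
    refine Finset.sum_le_card_nsmul _ _ _ fun i _ => ?_
    have h3 := h.noise i
    have h4 : (2 * |⟪X i, ε⟫|) ^ 2 ≤ (φ * √t) ^ 2 := by gcongr
    rw [mul_pow, mul_pow, sq_abs, Real.sq_sqrt ht] at h4
    linarith
  have h5 := h.eig_le T c hK hc
  have hA : 0 ≤ ∑ i ∈ T, c i ^ 2 := Finset.sum_nonneg fun _ _ => sq_nonneg _
  calc ⟪comb X c, ε⟫ ^ 2 ≤ (∑ i ∈ T, c i ^ 2) * ∑ i ∈ T, ⟪X i, ε⟫ ^ 2 := by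
        rw [h1]
        exact Finset.sum_mul_sq_le_sq_mul_sq _ _ _
    _ ≤ (∑ i ∈ T, c i ^ 2) * (T.card * (φ ^ 2 * t / 4)) := by gcongr
    _ = φ * t * T.card / 4 * (φ * ∑ i ∈ T, c i ^ 2) := by ring
    _ ≤ φ * t * T.card / 4 * ‖comb X c‖ ^ 2 := by
        have := h.eig_pos.le
        gcongr

variable [FiniteDimensional ℝ E]

lemma SparseRegression.norm_proj_noise_sq_le (h : SparseRegression X θ ε S₀ φ t K) (ht : 0 ≤ t)
    {T : Finset ι} (hK : T.card ≤ K) : ‖proj X T ε‖ ^ 2 ≤ φ * t * T.card / 4 := by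
  have h1 := h.inner_noise_sq_le ht hK (proj_mem X T ε)
  rw [inner_proj_self] at h1
  rcases (sq_nonneg ‖proj X T ε‖).eq_or_lt with h0 | h0
  · rw [← h0]
    have := h.eig_pos.le
    positivity
  · rw [sq (‖proj X T ε‖ ^ 2)] at h1
    exact le_of_mul_le_mul_right h1 h0

lemma bias_eq (S : Finset ι) :
    bias X θ S = ‖comb X θ‖ ^ 2 - ‖proj X S (comb X θ)‖ ^ 2 := norm_sub_proj_sq X S _

lemma bias_nonneg (S : Finset ι) : 0 ≤ bias X θ S := sq_nonneg _

lemma bias_anti {S T : Finset ι} (h : S ⊆ T) : bias X θ T ≤ bias X θ S := by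
  rw [bias_eq, bias_eq]
  linarith [norm_proj_mono X h (comb X θ)]

variable [DecidableEq ι]

/-- Projecting on a working model changes only the coefficients in that model. -/
lemma SparseRegression.exists_residual_eq (h : SparseRegression X θ ε S₀ φ t K) (S : Finset ι) :
    ∃ c : ι → ℝ, (∀ i ∉ S₀ ∪ S, c i = 0) ∧ (∀ i ∉ S, c i = θ i) ∧
      comb X c = comb X θ - proj X S (comb X θ) := by
  obtain ⟨d, hd, hd'⟩ := exists_comb_eq X (proj_mem X S (comb X θ))
  refine ⟨fun i => θ i - d i, fun i hi => ?_, fun i hi => by simp [hd i hi], ?_⟩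
  · rw [Finset.mem_union, not_or] at hi
    simp [h.supp i hi.1, hd i hi.2]
  · rw [← hd']
    simp [comb, sub_smul, Finset.sum_sub_distrib]

lemma SparseRegression.restL2_le (h : SparseRegression X θ ε S₀ φ t K) {S : Finset ι}
    (hK : S.card + S₀.card ≤ K) : φ * restL2 θ S₀ S ≤ bias X θ S := by
  obtain ⟨c, hc, hcθ, hcomb⟩ := h.exists_residual_eq S
  rw [bias, ← hcomb]
  refine le_trans (mul_le_mul_of_nonneg_left ?_ h.eig_pos.le)
    (h.eig_le (S₀ ∪ S) c ((Finset.card_union_le _ _).trans (by omega)) hc)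
  rw [restL2]
  calc ∑ k ∈ S₀ \ S, θ k ^ 2 = ∑ k ∈ S₀ \ S, c k ^ 2 :=
        Finset.sum_congr rfl fun k hk => by rw [hcθ k (Finset.mem_sdiff.1 hk).2]
    _ ≤ ∑ k ∈ S₀ ∪ S, c k ^ 2 :=
        Finset.sum_le_sum_of_subset_of_nonneg
          (Finset.sdiff_subset.trans Finset.subset_union_left) fun _ _ _ => sq_nonneg _

lemma SparseRegression.inner_residual_noise_sq_le (h : SparseRegression X θ ε S₀ φ t K)
    (ht : 0 ≤ t) {S : Finset ι} (hK : S.card + S₀.card ≤ K) :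
    ⟪comb X θ - proj X S (comb X θ), ε⟫ ^ 2
      ≤ φ * t * (S.card + S₀.card) / 4 * bias X θ S := by
  obtain ⟨c, hc, -, hcomb⟩ := h.exists_residual_eq S
  have h1 := h.inner_noise_sq_le ht ((Finset.card_union_le _ _).trans (by omega))
    (hcomb ▸ comb_mem_covSpan X hc)
  refine h1.trans ?_
  have h2 : ((S₀ ∪ S).card : ℝ) ≤ S.card + S₀.card := by
    have := Finset.card_union_le S₀ S
    rw [add_comm]
    exact_mod_cast this
  have := h.eig_pos.le
  unfold bias
  gcongr

/-- If no covariate outside `S` gains more than `G ^ 2`, then Hölder's inequality bounds the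
covariance of the unexplained signal with the response. -/
lemma SparseRegression.bias_add_le (h : SparseRegression X θ ε S₀ φ t K) {S : Finset ι} {G : ℝ}
    (hG : 0 ≤ G) (hgain : ∀ k ∉ S, gain X (comb X θ + ε) S k ≤ G ^ 2) :
    bias X θ S + ⟪comb X θ - proj X S (comb X θ), ε⟫ ≤ restL1 θ S₀ S * G := by
  set y := comb X θ + ε with hy
  have h1 : ⟪comb X θ - proj X S (comb X θ), y⟫
      = bias X θ S + ⟪comb X θ - proj X S (comb X θ), ε⟫ := by
    rw [hy, inner_add_right, bias_eq, inner_sub_left, inner_proj_self, real_inner_self_eq_norm_sq]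
  have h2 : comb X θ - proj X S (comb X θ) = ∑ k ∈ S₀ \ S, θ k • (X k - proj X S (X k)) := by
    rw [comb_eq_sum X h.supp, map_sum, ← Finset.sum_sub_distrib]
    symm
    rw [Finset.sum_subset (Finset.sdiff_subset : S₀ \ S ⊆ S₀)]
    · exact Finset.sum_congr rfl fun k _ => by rw [map_smul, smul_sub]
    · intro k hk hk'
      have : k ∈ S := by simpa [hk] using hk'
      rw [proj_eq_self X (mem_covSpan X this), sub_self, smul_zero]
  rw [← h1, h2, sum_inner, restL1, Finset.sum_mul]
  refine Finset.sum_le_sum fun k hk => ?_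
  rw [real_inner_smul_left]
  refine (le_abs_self _).trans ?_
  rw [abs_mul]
  gcongr
  exact abs_le_of_sq_le_sq ((inner_residual_sq_le_gain X y S (h.norm_le k)).trans
    (hgain k (Finset.mem_sdiff.1 hk).2)) hG

end Bounds
/-! ### The potential -/

/-- Effect of a step on `L ^ 2 / b` when `L` is unchanged: `b` is the unexplained signal before the
step and `b'` after it, `G`, `D` and `e` are the lengths of the parts of the response, signal and
noise that the step explains. Unless the noise part is at least three quarters of `√t`, the signal
part is a fixed proportion of `G ≥ b / (2 L)`. -/
lemma potential_step {b b' L G D e t : ℝ} (hb' : 0 < b') (hD : D ^ 2 = b - b')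
    (hG : 0 ≤ G) (ht : 0 < t) (htG : t < G ^ 2) (hGDe : G ≤ D + e)
    (hbG : b ≤ 2 * (L * G)) :
    (1 - 16 / 9 * (e ^ 2 / t)) / 64 ≤ L ^ 2 / b' - L ^ 2 / b := by
  have hb : b' ≤ b := by nlinarith [sq_nonneg D]
  have hb0 : 0 < b := hb'.trans_le hb
  by_cases hcase : 9 / 16 * t ≤ e ^ 2
  · have h1 : 9 / 16 ≤ e ^ 2 / t := by rwa [le_div_iff₀ ht]
    have h2 : L ^ 2 / b ≤ L ^ 2 / b' := by gcongr
    linarith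
  · push Not at hcase
    have h1 : e ≤ 3 / 4 * G := by
      refine abs_le_of_sq_le_sq' ?_ (by positivity) |>.2
      nlinarith
    have h2 : G ^ 2 / 16 ≤ D ^ 2 := by
      have : G / 4 ≤ D := by linarith
      nlinarith
    have h3 : b ^ 2 ≤ 4 * (L ^ 2 * G ^ 2) := by
      calc b ^ 2 ≤ (2 * (L * G)) ^ 2 := by gcongr
        _ = _ := by ring
    have h4 : L ^ 2 / b' - L ^ 2 / b = L ^ 2 * D ^ 2 / (b * b') := by
      rw [hD]
      field_simp
    have h5 : 1 / 64 ≤ L ^ 2 * D ^ 2 / (b * b') := by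
      rw [div_le_div_iff₀ (by norm_num) (by positivity)]
      have h6 : b * b' ≤ b ^ 2 := by nlinarith
      have h7 : L ^ 2 * (G ^ 2 / 16) ≤ L ^ 2 * D ^ 2 := by gcongr
      linarith
    have h8 : 0 ≤ e ^ 2 / t := by positivity
    rw [h4]
    linarith

/-- Effect on the potential of removing a coefficient `a` from the remaining part of `θ`: the
loss of order `2 a L / b` is made up for by the increase of `L ^ 2 / Q`. -/
lemma potential_remove {φ a L Q b b' : ℝ} (hQ : 0 < Q) (hb' : 0 < b') (hbb : b' ≤ b)
    (ha : 0 ≤ a) (hL : 0 ≤ L) (hφ : 0 < φ) (hb : φ * (Q + a ^ 2) ≤ b) :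
    φ * ((L + a) ^ 2 / b) + (L + a) ^ 2 / (Q + a ^ 2) - 4 ≤ φ * (L ^ 2 / b') + L ^ 2 / Q := by
  have hb0 : 0 < b := hb'.trans_le hbb
  have hQa : 0 < Q + a ^ 2 := by positivity
  have h1 : φ * (L ^ 2 / b) ≤ φ * (L ^ 2 / b') := by gcongr
  have h2 : φ * ((L + a) ^ 2 / b) - φ * (L ^ 2 / b) ≤ (2 * a * L + a ^ 2) / (Q + a ^ 2) := by
    have : φ * ((L + a) ^ 2 / b) - φ * (L ^ 2 / b) = φ * (2 * a * L + a ^ 2) / b := by ring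
    rw [this, div_le_div_iff₀ hb0 hQa]
    have h3 : 0 ≤ 2 * a * L + a ^ 2 := by positivity
    nlinarith [mul_le_mul_of_nonneg_left hb h3]
  have h4 : (2 * a * L + a ^ 2) / (Q + a ^ 2) + (L + a) ^ 2 / (Q + a ^ 2) - 4 ≤ L ^ 2 / Q := by
    have h5 : L ^ 2 / Q + 4 - ((2 * a * L + a ^ 2) / (Q + a ^ 2) + (L + a) ^ 2 / (Q + a ^ 2))
        = ((a * L - 2 * Q) ^ 2 + 2 * a ^ 2 * Q) / (Q * (Q + a ^ 2)) := by
      field_simp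
      ring
    have h6 : 0 ≤ ((a * L - 2 * Q) ^ 2 + 2 * a ^ 2 * Q) / (Q * (Q + a ^ 2)) := by positivity
    linarith
  linarith

section PhaseOne

variable {ι E : Type*} [Fintype ι] [DecidableEq ι] [NormedAddCommGroup E] [InnerProductSpace ℝ E]
  [FiniteDimensional ℝ E] {X : ι → E} {θ : ι → ℝ} {ε : E} {S₀ : Finset ι} {φ t : ℝ} {K : ℕ}

/-- The potential that controls the number of steps. Selecting an index outside `S₀` raises its first
term, and its second term makes up for the decrease of the first when an index of `S₀` is selected.
The quotients are zero by convention once nothing is left to explain. -/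
noncomputable def potential (X : ι → E) (θ : ι → ℝ) (S₀ : Finset ι) (φ : ℝ) (S : Finset ι) : ℝ :=
  φ * (restL1 θ S₀ S ^ 2 / bias X θ S) + restL1 θ S₀ S ^ 2 / restL2 θ S₀ S

lemma potential_nonneg (hφ : 0 ≤ φ) (S : Finset ι) : 0 ≤ potential X θ S₀ φ S := by
  have := bias_nonneg (X := X) (θ := θ) S
  have := restL2_nonneg θ S₀ S
  unfold potential
  positivity

lemma SparseRegression.potential_le (h : SparseRegression X θ ε S₀ φ t K) {S : Finset ι}
    (hK : S.card + S₀.card ≤ K) : potential X θ S₀ φ S ≤ 2 * S₀.card := by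
  have h1 := restL1_sq_le θ S₀ S
  have h2 := h.restL2_le hK
  have h3 := restL2_nonneg θ S₀ S
  have h4 : φ * (restL1 θ S₀ S ^ 2 / bias X θ S) ≤ S₀.card := by
    rw [← mul_div_assoc]
    refine div_le_of_le_mul₀ (bias_nonneg S) (by positivity) ?_
    calc φ * restL1 θ S₀ S ^ 2 ≤ φ * (S₀.card * restL2 θ S₀ S) :=
          mul_le_mul_of_nonneg_left h1 h.eig_pos.le
      _ = S₀.card * (φ * restL2 θ S₀ S) := by ring
      _ ≤ S₀.card * bias X θ S := by gcongr
  have h5 : restL1 θ S₀ S ^ 2 / restL2 θ S₀ S ≤ S₀.card :=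
    div_le_of_le_mul₀ h3 (by positivity) h1
  unfold potential
  linarith

/-- A signal that is not fully explained has a nonzero coefficient left. -/
lemma SparseRegression.restL2_pos (h : SparseRegression X θ ε S₀ φ t K) {S : Finset ι}
    (hb : 0 < bias X θ S) : 0 < restL2 θ S₀ S := by
  refine (restL2_nonneg θ S₀ S).lt_of_ne fun h0 => hb.ne' ?_
  have h1 : comb X θ ∈ covSpan X S := by
    refine comb_mem_covSpan X fun i hi => ?_
    by_cases hi0 : i ∈ S₀
    · exact pow_eq_zero_iff (two_ne_zero) |>.1 ((Finset.sum_eq_zero_iff_of_nonneg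
        fun _ _ => sq_nonneg _).1 h0.symm i (Finset.mem_sdiff.2 ⟨hi0, hi⟩))
    · exact h.supp i hi0
  rw [bias, proj_eq_self X h1, sub_self, norm_zero, zero_pow two_ne_zero]

/-- As long as the unexplained signal exceeds the noise level, every step raises the potential on
average, apart from bounded losses at the steps that select an index of `S₀`. Noisy steps are
charged to the total noise `‖proj X S ε‖ ^ 2` that the model explains. -/
lemma SparseRegression.le_potential (h : SparseRegression X θ ε S₀ φ t K) (ht : 0 < t)
    {S : Finset ι} (hS : Greedy X (comb X θ + ε) t S) (hK : S.card + S₀.card ≤ K)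
    (hb : φ * t * (S.card + S₀.card) < bias X θ S) :
    φ / 64 * (S.card - 16 / 9 * (‖proj X S ε‖ ^ 2 / t)) - 5 * (S ∩ S₀).card
      ≤ potential X θ S₀ φ S := by
  have hφ := h.eig_pos
  induction hS with
  | init =>
    refine le_trans ?_ (potential_nonneg hφ.le ∅)
    have : 0 ≤ φ / 64 * (16 / 9 * (‖proj X ∅ ε‖ ^ 2 / t)) := by positivity
    simp only [Finset.card_empty, Nat.cast_zero, Finset.empty_inter]
    linarith
  | update S j _ hj htg hmax ih =>
    rw [Finset.card_insert_of_notMem hj] at hK hb ⊢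
    have hsub : S ⊆ insert j S := Finset.subset_insert j S
    have hbb := bias_anti (X := X) (θ := θ) hsub
    have hb' : 0 < bias X θ (insert j S) := lt_of_le_of_lt (by positivity) hb
    have hbS : φ * t * (S.card + S₀.card) < bias X θ S := by
      refine lt_of_le_of_lt ?_ (hb.trans_le hbb)
      push_cast
      gcongr
      linarith
    have hKS : S.card + S₀.card ≤ K := by omega
    specialize ih hKS hbS
    have hb0 : 0 < bias X θ S := hb'.trans_le hbb
    have hgain : gain X (comb X θ + ε) S j
        = ‖proj X (insert j S) (comb X θ + ε) - proj X S (comb X θ + ε)‖ ^ 2 := gain_eq _ _ _ _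
    set G := ‖proj X (insert j S) (comb X θ + ε) - proj X S (comb X θ + ε)‖ with hG
    set D := ‖proj X (insert j S) (comb X θ) - proj X S (comb X θ)‖ with hD
    set e := ‖proj X (insert j S) ε - proj X S ε‖ with he
    have hD2 : D ^ 2 = bias X θ S - bias X θ (insert j S) := by
      rw [hD, norm_proj_sub_proj_sq X hsub, bias_eq, bias_eq]
      ring
    have he2 : ‖proj X (insert j S) ε‖ ^ 2 = ‖proj X S ε‖ ^ 2 + e ^ 2 := by
      rw [he, norm_proj_sub_proj_sq X hsub]
      ring
    have hGDe : G ≤ D + e := by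
      have : proj X (insert j S) (comb X θ + ε) - proj X S (comb X θ + ε)
          = (proj X (insert j S) (comb X θ) - proj X S (comb X θ))
            + (proj X (insert j S) ε - proj X S ε) := by
        simp only [map_add]
        abel
      rw [hG, this]
      exact norm_add_le _ _
    have hbG : bias X θ S ≤ 2 * (restL1 θ S₀ S * G) := by
      have h1 := h.bias_add_le (norm_nonneg _) (S := S) (G := G)
        fun k hk => (hmax k hk).trans hgain.le
      have h2 := h.inner_residual_noise_sq_le ht.le hKS
      have h3 : |⟪comb X θ - proj X S (comb X θ), ε⟫| ≤ bias X θ S / 2 := by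
        refine abs_le_of_sq_le_sq (h2.trans ?_) (by positivity)
        nlinarith
      linarith [neg_abs_le ⟪comb X θ - proj X S (comb X θ), ε⟫]
    have hstep := potential_step hb' hD2 (norm_nonneg _) ht
      (hgain ▸ htg) hGDe hbG
    rw [he2]
    push_cast
    by_cases hj0 : j ∈ S₀
    · have hcard : (insert j S ∩ S₀).card = (S ∩ S₀).card + 1 := by
        rw [Finset.insert_inter_of_mem hj0, Finset.card_insert_of_notMem (by simp [hj])]
      have hL : restL1 θ S₀ S = restL1 θ S₀ (insert j S) + |θ j| :=
        sum_sdiff_insert S₀ _ hj0 hj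
      have hQ : restL2 θ S₀ S = restL2 θ S₀ (insert j S) + |θ j| ^ 2 := by
        rw [sq_abs]
        exact sum_sdiff_insert S₀ _ hj0 hj
      have hrem := potential_remove (h.restL2_pos hb') hb' hbb (abs_nonneg (θ j))
        (restL1_nonneg θ S₀ (insert j S)) hφ (hQ ▸ h.restL2_le hKS)
      rw [← hL, ← hQ] at hrem
      rw [hcard]
      push_cast
      unfold potential at ih ⊢
      have h1 : φ / 64 * (S.card + 1 - 16 / 9 * ((‖proj X S ε‖ ^ 2 + e ^ 2) / t))
          ≤ φ / 64 * (S.card - 16 / 9 * (‖proj X S ε‖ ^ 2 / t)) + 1 := by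
        have h2 : 0 ≤ φ / 64 * (16 / 9 * (e ^ 2 / t)) := by positivity
        have h3 := h.eig_le_one
        rw [add_div]
        linarith
      linarith
    · have hcard : insert j S ∩ S₀ = S ∩ S₀ := Finset.insert_inter_of_notMem hj0
      have hL : restL1 θ S₀ (insert j S) = restL1 θ S₀ S := by
        rw [restL1, sdiff_insert_of_notMem S₀ hj0, restL1]
      have hQ : restL2 θ S₀ (insert j S) = restL2 θ S₀ S := by
        rw [restL2, sdiff_insert_of_notMem S₀ hj0, restL2]
      rw [hcard]
      unfold potential at ih ⊢
      rw [hL, hQ]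
      have := mul_le_mul_of_nonneg_left hstep hφ.le
      rw [add_div]
      linarith

lemma SparseRegression.card_le_of_lt_bias (h : SparseRegression X θ ε S₀ φ t K) (ht : 0 < t)
    {S : Finset ι} (hS : Greedy X (comb X θ + ε) t S) (hK : S.card + S₀.card ≤ K)
    (hb : φ * t * (S.card + S₀.card) < bias X θ S) : φ * S.card ≤ 807 * S₀.card := by
  have h1 := h.le_potential ht hS hK hb
  have h2 := h.potential_le hK
  have h3 := h.norm_proj_noise_sq_le ht.le (T := S) (by omega)
  have h4 : ‖proj X S ε‖ ^ 2 / t ≤ S.card / 4 := by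
    rw [div_le_iff₀ ht]
    refine h3.trans ?_
    have : φ * (t * S.card) ≤ 1 * (t * S.card) := by
      have := h.eig_le_one
      gcongr
    linarith
  have h5 : ((S ∩ S₀).card : ℝ) ≤ S₀.card := by
    exact_mod_cast Finset.card_le_card Finset.inter_subset_right
  have h6 := mul_le_mul_of_nonneg_left h4 h.eig_pos.le
  have h7 : (0 : ℝ) ≤ S₀.card := by positivity
  linarith

end PhaseOne

/-! ### The number of selected covariates -/

section Count

variable {ι E : Type*} [Fintype ι] [DecidableEq ι] [NormedAddCommGroup E] [InnerProductSpace ℝ E]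
  [FiniteDimensional ℝ E] {X : ι → E} {θ : ι → ℝ} {ε : E} {S₀ : Finset ι} {φ t : ℝ} {K : ℕ}

/-- Either the unexplained signal still exceeds the noise level, or it fell below the noise level at
an earlier model `S` of controlled size. Since then, every step gained more than `t`. -/
lemma SparseRegression.lt_bias_or_exists (h : SparseRegression X θ ε S₀ φ t K) (ht : 0 < t)
    {T : Finset ι} (hT : Greedy X (comb X θ + ε) t T) (hK : T.card + S₀.card ≤ K) :
    φ * t * (T.card + S₀.card) < bias X θ T ∨
      ∃ S ⊆ T, φ * S.card ≤ 808 * S₀.card ∧ bias X θ S ≤ φ * t * (S.card + S₀.card) ∧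
        t * (T.card - S.card) ≤
          ‖proj X T (comb X θ + ε)‖ ^ 2 - ‖proj X S (comb X θ + ε)‖ ^ 2 := by
  induction hT with
  | init =>
    rcases lt_or_ge (φ * t * ((∅ : Finset ι).card + S₀.card)) (bias X θ ∅) with hb | hb
    · exact .inl hb
    · exact .inr ⟨∅, subset_rfl, by simp, hb, by simp⟩
  | update T j hT hj htg hmax ih =>
    have hcard : (insert j T).card = T.card + 1 := Finset.card_insert_of_notMem hj
    have hKT : T.card + S₀.card ≤ K := by omega
    rcases ih hKT with hb | ⟨S, hST, hS, hbS, hg⟩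
    · rcases lt_or_ge (φ * t * ((insert j T).card + S₀.card)) (bias X θ (insert j T))
        with hb' | hb'
      · exact .inl hb'
      · refine .inr ⟨insert j T, subset_rfl, ?_, hb', by simp⟩
        have h1 := h.card_le_of_lt_bias ht hT hKT hb
        -- A signal above the noise level is not zero, so `S₀` is not empty.
        have h2 : (1 : ℝ) ≤ S₀.card := by
          by_contra hlt
          have h0 : S₀ = ∅ := by
            rw [← Finset.card_eq_zero]
            by_contra hne
            exact hlt (by exact_mod_cast Nat.one_le_iff_ne_zero.2 hne)
          have h3 := h.restL2_pos (lt_of_le_of_lt (by have := h.eig_pos; positivity) hb)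
          simp [restL2, h0] at h3
        have h3 := h.eig_le_one
        rw [hcard]
        push_cast
        linarith
    · refine .inr ⟨S, hST.trans (Finset.subset_insert j T), hS, hbS, ?_⟩
      rw [hcard]
      push_cast
      unfold gain at htg
      linarith

lemma SparseRegression.card_le_of_pos (h : SparseRegression X θ ε S₀ φ t K) (ht : 0 < t)
    {T : Finset ι} (hT : Greedy X (comb X θ + ε) t T) (hK : T.card + S₀.card ≤ K) :
    φ * T.card ≤ 5000 * S₀.card := by
  have h7 : (0 : ℝ) ≤ S₀.card := by positivity
  rcases h.lt_bias_or_exists ht hT hK with hb | ⟨S, hST, hS, hbS, hg⟩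
  · linarith [h.card_le_of_lt_bias ht hT hK hb]
  have hφ := h.eig_pos
  have hφ1 := h.eig_le_one
  have hnoise := h.norm_proj_noise_sq_le ht.le (T := T) (by omega)
  rw [← norm_proj_sub_proj_sq X hST] at hg
  have h1 : ‖proj X T (comb X θ + ε) - proj X S (comb X θ + ε)‖ ^ 2
      ≤ 2 * (bias X θ S + ‖proj X T ε‖ ^ 2) := by
    have h2 : proj X T (comb X θ + ε) - proj X S (comb X θ + ε)
        = (proj X T (comb X θ) - proj X S (comb X θ)) + (proj X T ε - proj X S ε) := by
      simp only [map_add]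
      abel
    have h3 : ‖proj X T (comb X θ) - proj X S (comb X θ)‖ ^ 2 ≤ bias X θ S := by
      rw [norm_proj_sub_proj_sq X hST]
      have := bias_nonneg (X := X) (θ := θ) T
      rw [bias_eq] at this ⊢
      linarith
    have h4 : ‖proj X T ε - proj X S ε‖ ^ 2 ≤ ‖proj X T ε‖ ^ 2 := by
      rw [norm_proj_sub_proj_sq X hST]
      linarith [sq_nonneg ‖proj X S ε‖]
    rw [h2]
    calc _ ≤ (‖proj X T (comb X θ) - proj X S (comb X θ)‖ + ‖proj X T ε - proj X S ε‖) ^ 2 := by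
          gcongr
          exact norm_add_le _ _
      _ ≤ _ := by
          refine (add_sq_le).trans ?_
          linarith
  have h5 : φ * (t * (S.card + S₀.card)) ≤ 1 * (t * (S.card + S₀.card)) := by gcongr
  have h6 : φ * (t * T.card) ≤ 1 * (t * T.card) := by gcongr
  have h8 : (T.card : ℝ) ≤ 6 * S.card + 4 * S₀.card := by
    refine le_of_mul_le_mul_left ?_ ht
    linarith
  have h9 : φ * S₀.card ≤ 1 * S₀.card := by gcongr
  have h10 := mul_le_mul_of_nonneg_left h8 hφ.le
  linarith

/-- Forward regression selects a number of covariates proportional to the sparsity. -/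
lemma SparseRegression.card_le (h : SparseRegression X θ ε S₀ φ t K) (ht : 0 ≤ t)
    {T : Finset ι} (hT : Greedy X (comb X θ + ε) t T) (hK : T.card + S₀.card ≤ K) :
    φ * T.card ≤ 5000 * S₀.card := by
  obtain ⟨t', ht', hT'⟩ := hT.exists_lt
  have h' : SparseRegression X θ ε S₀ φ t' K :=
    { h with
      noise := fun j => (h.noise j).trans (by
        have := h.eig_pos
        gcongr) }
  exact h'.card_le_of_pos (ht.trans_lt ht') hT' hK

/-- At a model where no remaining gain exceeds `t`, the fitted values are close to the signal. -/
lemma SparseRegression.norm_sub_proj_le (h : SparseRegression X θ ε S₀ φ t K) (ht : 0 ≤ t)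
    {S : Finset ι} (hK : S.card + S₀.card ≤ K)
    (hterm : ∀ k ∉ S, gain X (comb X θ + ε) S k ≤ t) :
    φ * ‖comb X θ - proj X S (comb X θ + ε)‖ ^ 2 ≤ 3 * t * (S.card + S₀.card) := by
  have hφ := h.eig_pos
  have hφ1 := h.eig_le_one
  have hsplit : ‖comb X θ - proj X S (comb X θ + ε)‖ ^ 2 = bias X θ S + ‖proj X S ε‖ ^ 2 := by
    rw [norm_sub_sq_of_mem X (proj_mem X S _), map_add, sub_add_cancel_left, norm_neg, bias]
  have hnoise := h.norm_proj_noise_sq_le ht (T := S) (by omega)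
  have h1 := h.bias_add_le (S := S) (Real.sqrt_nonneg t) (by rwa [Real.sq_sqrt ht])
  have hb := bias_nonneg (X := X) (θ := θ) S
  have h2 : |⟪comb X θ - proj X S (comb X θ), ε⟫|
      ≤ bias X θ S / 4 + φ * t * (S.card + S₀.card) / 4 := by
    refine abs_le_of_sq_le_sq ((h.inner_residual_noise_sq_le ht hK).trans ?_) (by positivity)
    nlinarith [sq_nonneg (bias X θ S / 4 - φ * t * (S.card + S₀.card) / 4)]
  have h3 : restL1 θ S₀ S * √t ≤ bias X θ S / 4 + S₀.card * t / φ := by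
    have h4 : (restL1 θ S₀ S * √t) ^ 2 ≤ bias X θ S * (S₀.card * t / φ) := by
      rw [mul_pow, Real.sq_sqrt ht, ← mul_div_assoc, le_div_iff₀ hφ]
      calc restL1 θ S₀ S ^ 2 * t * φ ≤ S₀.card * restL2 θ S₀ S * t * φ := by
            gcongr
            exact restL1_sq_le θ S₀ S
        _ = φ * restL2 θ S₀ S * (S₀.card * t) := by ring
        _ ≤ bias X θ S * (S₀.card * t) := by
            gcongr
            exact h.restL2_le hK
    refine (abs_le_of_sq_le_sq' (h4.trans ?_) (by positivity)).2
    nlinarith [sq_nonneg (bias X θ S / 4 - S₀.card * t / φ)]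
  have h5 : bias X θ S / 2 ≤ S₀.card * t / φ + φ * t * (S.card + S₀.card) / 4 := by
    linarith [neg_abs_le ⟪comb X θ - proj X S (comb X θ), ε⟫]
  have h6 := mul_le_mul_of_nonneg_left h5 hφ.le
  rw [mul_add, mul_div_cancel₀ _ hφ.ne'] at h6
  have h7 := mul_le_mul_of_nonneg_left hnoise hφ.le
  have hφ2 : φ * φ ≤ 1 := by nlinarith
  have h8 : φ * φ * (t * (S.card + S₀.card)) ≤ 1 * (t * (S.card + S₀.card)) := by gcongr
  have h9 : φ * φ * (t * S.card) ≤ 1 * (t * S.card) := by gcongr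
  have h10 : 0 ≤ t * S.card := by positivity
  have h11 : 0 ≤ t * S₀.card := by positivity
  rw [hsplit]
  linarith

end Count
/-! ### Data as vectors in a Hilbert space -/

section Data

variable {n p : ℕ}

/-- The embedding of `ℝⁿ` into Euclidean space, scaled by `1 / √n` so that the inner product is `En`
of the product. -/
noncomputable def emb (n : ℕ) : (Fin n → ℝ) →ₗ[ℝ] EuclideanSpace ℝ (Fin n) :=
  (√(n : ℝ))⁻¹ • (WithLp.linearEquiv 2 ℝ (Fin n → ℝ)).symm.toLinearMap

/-- The covariate `j` as a vector. -/
noncomputable def covVec (x : Matrix (Fin n) (Fin p) ℝ) (j : Fin p) : EuclideanSpace ℝ (Fin n) :=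
  emb n fun i => x i j

lemma inner_emb (f g : Fin n → ℝ) : ⟪emb n f, emb n g⟫ = En fun i => f i * g i := by
  have hn : (√(n : ℝ))⁻¹ * (√(n : ℝ))⁻¹ = 1 / n := by
    rw [← mul_inv, Real.mul_self_sqrt (Nat.cast_nonneg n), one_div]
  simp only [emb, LinearMap.smul_apply, real_inner_smul_left, real_inner_smul_right, En,
    ← mul_assoc, hn]
  congr 1
  simp [PiLp.inner_apply, mul_comm]

lemma norm_emb_sq (f : Fin n → ℝ) : ‖emb n f‖ ^ 2 = En fun i => f i ^ 2 := by
  rw [← real_inner_self_eq_norm_sq, inner_emb]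
  simp only [sq]

lemma comb_covVec (x : Matrix (Fin n) (Fin p) ℝ) (c : Fin p → ℝ) :
    comb (covVec x) c = emb n (x *ᵥ c) := by
  simp only [comb, covVec, ← map_smul, ← map_sum]
  congr 1
  ext i
  simp [Matrix.mulVec, dotProduct, mul_comm]

lemma loss_eq (x : Matrix (Fin n) (Fin p) ℝ) (y : Fin n → ℝ) (θ : Fin p → ℝ) :
    loss x y θ = ‖emb n y - comb (covVec x) θ‖ ^ 2 := by
  rw [comb_covVec, ← map_sub, norm_emb_sq]
  rfl

lemma predErr_eq (x : Matrix (Fin n) (Fin p) ℝ) (θ₀ θ : Fin p → ℝ) :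
    predErr x θ₀ θ = ‖comb (covVec x) θ₀ - comb (covVec x) θ‖ := by
  rw [comb_covVec, comb_covVec, ← map_sub, ← Real.sqrt_sq (norm_nonneg _), norm_emb_sq]
  rfl

lemma setLoss_eq (x : Matrix (Fin n) (Fin p) ℝ) (y : Fin n → ℝ) (S : Finset (Fin p)) :
    setLoss x y S = ‖emb n y - proj (covVec x) S (emb n y)‖ ^ 2 := by
  refine IsLeast.csInf_eq ⟨?_, ?_⟩
  · obtain ⟨c, hc, hc'⟩ := exists_comb_eq (covVec x) (proj_mem (covVec x) S (emb n y))
    exact ⟨c, hc, by rw [loss_eq, hc']⟩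
  · rintro _ ⟨θ, hθ, rfl⟩
    rw [loss_eq, norm_sub_sq_of_mem (covVec x) (comb_mem_covSpan (covVec x) hθ)]
    exact le_add_of_nonneg_right (sq_nonneg _)

lemma neg_incLoss_eq (x : Matrix (Fin n) (Fin p) ℝ) (y : Fin n → ℝ) (j : Fin p)
    (S : Finset (Fin p)) : -incLoss x y j S = gain (covVec x) (emb n y) S j := by
  rw [incLoss, setLoss_eq, setLoss_eq, norm_sub_proj_sq, norm_sub_proj_sq, gain]
  ring

lemma Reachable.greedy {x : Matrix (Fin n) (Fin p) ℝ} {y : Fin n → ℝ} {t : ℝ}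
    {S : Finset (Fin p)} (h : Reachable x y t S) : Greedy (covVec x) (emb n y) t S := by
  induction h with
  | init => exact .init
  | update S j _ hj ht hmax ih =>
    simp only [neg_incLoss_eq] at ht hmax
    exact .update S j ih hj ht hmax

lemma IsOutput.comb_eq {x : Matrix (Fin n) (Fin p) ℝ} {y : Fin n → ℝ} {t : ℝ}
    {S : Finset (Fin p)} {θ : Fin p → ℝ} (h : IsOutput x y t S θ) :
    comb (covVec x) θ = proj (covVec x) S (emb n y) := by
  obtain ⟨c, hc, hc'⟩ := exists_comb_eq (covVec x) (proj_mem (covVec x) S (emb n y))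
  have h1 := h.least c hc
  rw [loss_eq, loss_eq, hc',
    norm_sub_sq_of_mem (covVec x) (comb_mem_covSpan (covVec x) h.supported)] at h1
  have h2 : ‖proj (covVec x) S (emb n y) - comb (covVec x) θ‖ = 0 := by nlinarith
  exact (sub_eq_zero.1 (norm_eq_zero.1 h2)).symm

end Data

/-! ### Sparse eigenvalues -/

section Eigenvalue

/-- One half of the Rayleigh characterization of the smallest eigenvalue. -/
lemma lambdaMin_mul_le {ι : Type*} [Fintype ι] [DecidableEq ι] {A : Matrix ι ι ℝ}
    (hA : A.IsHermitian) (v : ι → ℝ) : lambdaMin A * (v ⬝ᵥ v) ≤ v ⬝ᵥ A *ᵥ v := by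
  have hpos : (A - algebraMap ℝ (Matrix ι ι ℝ) (lambdaMin A)).PosSemidef := by
    rw [Matrix.posSemidef_iff_isHermitian_and_spectrum_nonneg]
    refine ⟨hA.sub (Matrix.isHermitian_diagonal _), fun r hr => ?_⟩
    have h : r + lambdaMin A ∈ spectrum ℝ A := by
      rw [spectrum.add_mem_iff, neg_add_eq_sub]
      exact hr
    have h2 : lambdaMin A ≤ r + lambdaMin A := csInf_le Matrix.finite_real_spectrum.bddBelow h
    exact (le_add_iff_nonneg_left _).1 h2
  have := hpos.dotProduct_mulVec_nonneg v
  rw [Matrix.sub_mulVec, dotProduct_sub] at this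
  simp [Algebra.algebraMap_eq_smul_one, Matrix.smul_mulVec] at this
  linarith

variable {n p : ℕ} {x : Matrix (Fin n) (Fin p) ℝ} {K : ℕ}

lemma norm_comb_sq_eq (T : Finset (Fin p)) {c : Fin p → ℝ} (hc : ∀ i ∉ T, c i = 0) :
    ‖comb (covVec x) c‖ ^ 2 = (fun j : T => c j) ⬝ᵥ
      (gram x).submatrix (fun j : T => (j : Fin p)) (fun j : T => (j : Fin p)) *ᵥ
        fun j : T => c j := by
  rw [comb_eq_sum _ hc, ← real_inner_self_eq_norm_sq, sum_inner]
  simp only [dotProduct, Matrix.mulVec, Matrix.submatrix_apply, gram, Matrix.of_apply]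
  rw [← Finset.sum_coe_sort T]
  refine Finset.sum_congr rfl fun j _ => ?_
  rw [inner_sum, ← Finset.sum_coe_sort T, Finset.mul_sum]
  refine Finset.sum_congr rfl fun k _ => ?_
  rw [real_inner_smul_left, real_inner_smul_right, covVec, covVec, inner_emb]
  ring

lemma finite_sparse_eigs (s : ℕ) (G : Matrix (Fin p) (Fin p) ℝ) :
    {l | ∃ S : Finset (Fin p), S.Nonempty ∧ S.card ≤ s ∧
      l = lambdaMin (G.submatrix (fun j : S => (j : Fin p)) (fun j : S => (j : Fin p)))}.Finite := by
  refine (Set.finite_range fun S : Finset (Fin p) =>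
    lambdaMin (G.submatrix (fun j : S => (j : Fin p)) (fun j : S => (j : Fin p)))).subset ?_
  rintro _ ⟨S, -, -, rfl⟩
  exact ⟨S, rfl⟩

lemma sparseMinEig_mul_le (T : Finset (Fin p)) (hT : T.card ≤ K) {c : Fin p → ℝ}
    (hc : ∀ i ∉ T, c i = 0) :
    sparseMinEig K (gram x) * ∑ i ∈ T, c i ^ 2 ≤ ‖comb (covVec x) c‖ ^ 2 := by
  rcases T.eq_empty_or_nonempty with rfl | hne
  · simp
  have hsymm : ((gram x).submatrix (fun j : T => (j : Fin p))
      (fun j : T => (j : Fin p))).IsHermitian := by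
    ext j k
    simp [gram, mul_comm]
  have h1 := lambdaMin_mul_le hsymm fun j : T => c j
  rw [← norm_comb_sq_eq T hc] at h1
  have h2 : (fun j : T => c j) ⬝ᵥ (fun j : T => c j) = ∑ i ∈ T, c i ^ 2 := by
    rw [← Finset.sum_coe_sort T]
    simp [dotProduct, sq]
  rw [h2] at h1
  refine le_trans (mul_le_mul_of_nonneg_right ?_ (Finset.sum_nonneg fun _ _ => sq_nonneg _)) h1
  exact csInf_le (finite_sparse_eigs K _).bddBelow ⟨T, hne, hT, rfl⟩

lemma sparseMinEig_le_one (hx : Normalized x) (hK : 1 ≤ K)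
    (hpos : 0 < sparseMinEig K (gram x)) : sparseMinEig K (gram x) ≤ 1 := by
  -- Without covariates the infimum is over the empty set, hence zero.
  have hp : Nonempty (Fin p) := by
    by_contra hemp
    rw [not_nonempty_iff] at hemp
    refine hpos.ne' ?_
    rw [sparseMinEig]
    convert Real.sInf_empty
    refine Set.eq_empty_of_forall_notMem ?_
    rintro _ ⟨S, ⟨j, -⟩, -⟩
    exact hemp.elim j
  obtain ⟨j⟩ := hp
  have h := sparseMinEig_mul_le (x := x) {j} (by simpa using hK) (c := Pi.single j 1)
    fun i hi => Pi.single_eq_of_ne (by simpa using hi) 1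
  rw [comb_covVec, Matrix.mulVec_single_one] at h
  have h2 := (hx j).2
  simp [norm_emb_sq] at h
  simpa [h2] using h

end Eigenvalue

/-! ### Bounds for a given dataset -/

section FiniteSample

variable {n p K : ℕ} {x : Matrix (Fin n) (Fin p) ℝ} {y ε : Fin n → ℝ} {θ₀ θ : Fin p → ℝ} {t D : ℝ}
  {S : Finset (Fin p)}

lemma sparseRegression_of_data (hx : Normalized x) (hK : 1 ≤ K)
    (hpos : 0 < sparseMinEig K (gram x))
    (hnoise : 2 * (sparseMinEig K (gram x))⁻¹ * noiseSup x ε ≤ √t) :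
    SparseRegression (covVec x) θ₀ (emb n ε) (Finset.univ.filter fun j => θ₀ j ≠ 0)
      (sparseMinEig K (gram x)) t K where
  norm_le j := by
    have h : ‖covVec x j‖ ^ 2 = 1 := by rw [covVec, norm_emb_sq, (hx j).2]
    nlinarith [norm_nonneg (covVec x j)]
  eig_pos := hpos
  eig_le_one := sparseMinEig_le_one hx hK hpos
  eig_le T c hT hc := sparseMinEig_mul_le T hT hc
  supp i hi := by simpa using hi
  noise j := by
    have h1 : |⟪covVec x j, emb n ε⟫| ≤ noiseSup x ε := by
      rw [covVec, inner_emb]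
      exact norm_le_pi_norm (fun j => En (fun i => x i j * ε i) : Fin p → ℝ) j
    have h2 : 2 * (sparseMinEig K (gram x))⁻¹ * noiseSup x ε
        = 2 * noiseSup x ε / sparseMinEig K (gram x) := by ring
    rw [h2, div_le_iff₀ hpos] at hnoise
    linarith

lemma card_filter_ne_zero (θ : Fin p → ℝ) :
    (Finset.univ.filter fun j => θ j ≠ 0).card = sparsity θ := by
  rw [sparsity, ← Set.ncard_coe_finset]
  congr 1
  ext j
  simp

/-- The bounds for one dataset, with `D` an upper bound of the inverse sparse eigenvalue. -/
lemma IsOutput.bounds (hout : IsOutput x y t S θ) (hmodel : ∀ i, y i = (x *ᵥ θ₀) i + ε i)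
    (hx : Normalized x) (hK : 1 ≤ K) (ht : 0 ≤ t) (hpos : 0 < sparseMinEig K (gram x))
    (hD : (sparseMinEig K (gram x))⁻¹ ≤ D)
    (hnoise : 2 * (sparseMinEig K (gram x))⁻¹ * noiseSup x ε ≤ √t)
    (hKs : 5000 * D * sparsity θ₀ + 1 + sparsity θ₀ ≤ K) :
    (S.card : ℝ) ≤ 5000 * D * sparsity θ₀ ∧
      predErr x θ₀ θ ^ 2 ≤ 3 * D * (5000 * D + 1) * (sparsity θ₀ * t) := by
  have h := sparseRegression_of_data (θ₀ := θ₀) hx hK hpos hnoise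
  set φ := sparseMinEig K (gram x)
  set s := sparsity θ₀ with hs
  have hcard := card_filter_ne_zero θ₀
  have hy : emb n y = comb (covVec x) θ₀ + emb n ε := by
    rw [comb_covVec, ← map_add]
    congr 1
    ext i
    exact hmodel i
  have hD0 : 0 < D := (inv_pos.2 hpos).trans_le hD
  have hgreedy := hout.reachable.greedy
  rw [hy] at hgreedy
  have hdiv : ∀ a b : ℝ, 0 ≤ b → φ * a ≤ b → a ≤ D * b := fun a b hb hab => by
    calc a = φ⁻¹ * (φ * a) := by rw [inv_mul_cancel_left₀ hpos.ne']
      _ ≤ φ⁻¹ * b := by gcongr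
      _ ≤ D * b := by gcongr
  -- A larger model would contain a prefix of the path that is already too large, yet small enough
  -- for the sparse eigenvalue to apply.
  have hS : (S.card : ℝ) ≤ 5000 * D * s := by
    by_contra! hlt
    have h0 : 0 ≤ 5000 * D * s := by positivity
    obtain ⟨T, hT, hTm⟩ := hgreedy.exists_card_eq (m := ⌊5000 * D * (s : ℝ)⌋₊ + 1)
      (by exact_mod_cast (Nat.floor_lt h0).2 hlt)
    have hTK : T.card + s ≤ K := by
      have h1 := Nat.floor_le h0
      rw [hTm]
      have : ((⌊5000 * D * (s : ℝ)⌋₊ + 1 + s : ℕ) : ℝ) ≤ K := by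
        push_cast
        linarith
      exact_mod_cast this
    have h2 := h.card_le ht hT (by rwa [hcard])
    rw [hcard] at h2
    have h3 := hdiv _ _ (by positivity) h2
    have h4 := Nat.lt_floor_add_one (5000 * D * (s : ℝ))
    rw [hTm] at h3
    push_cast at h3
    linarith
  refine ⟨hS, ?_⟩
  have hSK : S.card + s ≤ K := by
    have : ((S.card + s : ℕ) : ℝ) ≤ K := by
      push_cast
      linarith
    exact_mod_cast this
  have h5 := h.norm_sub_proj_le ht (S := S) (by rwa [hcard]) fun k hk => by
    rw [← hy, ← neg_incLoss_eq]
    exact not_lt.1 (hout.terminal k hk)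
  rw [← hy, ← hout.comb_eq, ← predErr_eq, hcard] at h5
  refine (hdiv _ _ (by positivity) h5).trans ?_
  calc D * (3 * t * (S.card + s)) ≤ D * (3 * t * (5000 * D * s + s)) := by gcongr
    _ = _ := by ring

end FiniteSample

end ForwardRegression

theorem theorem2
    {Ω : ℕ → Type*} [∀ n, MeasurableSpace (Ω n)]
    (μ : ∀ n, Measure (Ω n)) [∀ n, IsProbabilityMeasure (μ n)]
    -- the datasets (sample size `n`, `p n` covariates), parameters, disturbances and thresholds
    (p : ℕ → ℕ)
    (x : ∀ n, Ω n → Matrix (Fin n) (Fin (p n)) ℝ)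
    (y : ∀ n, Ω n → Fin n → ℝ)
    (θ₀ : ∀ n, Fin (p n) → ℝ)
    (ε : ∀ n, Ω n → Fin n → ℝ)
    (t : ℕ → ℝ)
    (K : ℕ → ℕ)
    (hmodel : ∀ᶠ n in atTop, ∀ᵐ ω ∂(μ n), ∀ i, y n ω i = (x n ω *ᵥ θ₀ n) i + ε n ω i)
    (hnorm : ∀ᶠ n in atTop, ∀ᵐ ω ∂(μ n), ForwardRegression.Normalized (x n ω))
    -- model and sparsity
    (hsparse : (fun n => (ForwardRegression.sparsity (θ₀ n) : ℝ)) =o[atTop] fun n => (n : ℝ))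
    -- sparse eigenvalues
    (hK_pos : ∀ᶠ n in atTop, 1 ≤ K n)
    (hK : (fun n => (ForwardRegression.sparsity (θ₀ n) : ℝ)) =o[atTop] fun n => (K n : ℝ))
    (heig : ∃ C : ℝ, ForwardRegression.WithProbTendingToOne μ fun n ω =>
      0 < ForwardRegression.sparseMinEig (K n) (ForwardRegression.gram (x n ω)) ∧
      (ForwardRegression.sparseMinEig (K n) (ForwardRegression.gram (x n ω)))⁻¹ ≤ C)
    -- threshold and disturbance terms
    (ht_nonneg : ∀ᶠ n in atTop, 0 ≤ t n)
    (ht : t =O[atTop] fun n => Real.log (p n) / (n : ℝ))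
    (hnoise : ForwardRegression.WithProbTendingToOne μ fun n ω =>
      2 * (ForwardRegression.sparseMinEig (K n) (ForwardRegression.gram (x n ω)))⁻¹ *
        ForwardRegression.noiseSup (x n ω) (ε n ω) ≤ Real.sqrt (t n))
    -- the selected set and the estimator produced by forward regression
    (Shat : ∀ n, Ω n → Finset (Fin (p n)))
    (θhat : ∀ n, Ω n → Fin (p n) → ℝ)
    (hout : ∀ᶠ n in atTop, ∀ᵐ ω ∂(μ n),
      ForwardRegression.IsOutput (x n ω) (y n ω) (t n) (Shat n ω) (θhat n ω)) :
    ∃ C : ℝ, ForwardRegression.WithProbTendingToOne μ fun n ω =>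
      ForwardRegression.predErr (x n ω) (θ₀ n) (θhat n ω) ≤
        C * Real.sqrt (ForwardRegression.sparsity (θ₀ n) * Real.log (p n) / n) ∧
      ((Shat n ω).card : ℝ) ≤ C * ForwardRegression.sparsity (θ₀ n) := by
  obtain ⟨C₀, heig⟩ := heig
  obtain ⟨c, hc, ht⟩ := ht.exists_pos
  have ht := ht.bound
  -- Enlarging the constant makes it positive.
  set D := max C₀ 1 with hDdef
  have hD : 0 < D := lt_max_of_lt_right one_pos
  set B := 3 * D * (5000 * D + 1) with hB
  have hB0 : 0 < B := by positivity
  refine ⟨√(B * c) + 5000 * D, ?_⟩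
  have hlim := heig.add hnoise
  rw [add_zero] at hlim
  have hKs := hK.def (c := (5000 * D + 2)⁻¹) (by positivity)
  refine tendsto_of_tendsto_of_tendsto_of_le_of_le' tendsto_const_nhds hlim
    (Eventually.of_forall fun _ => zero_le) ?_
  filter_upwards [hmodel, hnorm, hK_pos, ht_nonneg, ht, hout, hKs]
    with n hmodel hnorm hK_pos ht_nonneg ht hout hKs
  refine (measure_mono_ae ?_).trans (measure_union_le _ _)
  filter_upwards [hmodel, hnorm, hout] with ω hmodel hnorm hout hfail
  by_contra hgood
  obtain ⟨h1, h2⟩ := not_or.1 hgood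
  obtain ⟨hpos, hinv⟩ := not_not.1 h1
  have hnoise := not_not.1 h2
  refine hfail ?_
  have hKs' : 5000 * D * ForwardRegression.sparsity (θ₀ n) + 1 + ForwardRegression.sparsity (θ₀ n)
      ≤ (K n : ℝ) := by
    rcases Nat.eq_zero_or_pos (ForwardRegression.sparsity (θ₀ n)) with h0 | h0
    · rw [h0]
      simpa using hK_pos
    · have h3 : (1 : ℝ) ≤ ForwardRegression.sparsity (θ₀ n) := by exact_mod_cast h0
      rw [Real.norm_natCast, Real.norm_natCast, inv_mul_eq_div, le_div_iff₀ (by positivity)] at hKs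
      linarith
  obtain ⟨hcard, herr⟩ := hout.bounds hmodel hnorm hK_pos ht_nonneg hpos
    (hinv.trans (le_max_left _ _)) hnoise hKs'
  have hlog : 0 ≤ Real.log (p n) / n := div_nonneg (Real.log_natCast_nonneg _) (Nat.cast_nonneg n)
  rw [Real.norm_of_nonneg ht_nonneg, Real.norm_of_nonneg hlog] at ht
  constructor
  · have h3 : ForwardRegression.predErr (x n ω) (θ₀ n) (θhat n ω) ≤
        √(B * c) * √(ForwardRegression.sparsity (θ₀ n) * Real.log (p n) / n) := by
      rw [← Real.sqrt_mul (by positivity)]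
      refine Real.le_sqrt_of_sq_le (herr.trans ?_)
      calc B * (ForwardRegression.sparsity (θ₀ n) * t n)
          ≤ B * (ForwardRegression.sparsity (θ₀ n) * (c * (Real.log (p n) / n))) := by gcongr
        _ = _ := by ring
    refine h3.trans (mul_le_mul_of_nonneg_right ?_ (Real.sqrt_nonneg _))
    linarith
  · refine hcard.trans (mul_le_mul_of_nonneg_right ?_ (Nat.cast_nonneg _))
    linarith [Real.sqrt_nonneg (B * c)]
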